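/- Setting. Let $d,q,k\in\mathbb N$, let $\mathcal T$ be a $k$-dimensional simplicial complex in $\mathbb R^d$, let $\mathcal S$ be a finite set of $k$-simplices of $\mathcal T$, and let $U=\bigcup_{\tau\in\mathcal S}\tau$, equipped with the $k$-dimensional volume $d\mathbf x$. $L^2(U;\mathbb R^q)$ carries the inner product $(\mathbf u,\mathbf w)=\int_U\mathbf u^{\rm T}\mathbf w\,d\mathbf x$. Let $(\Omega,\mathcal F,\mathbb P)$ be a probability space and let $\mathbf v\in L^2_{\mathbb P}(\Omega;L^2(U;\mathbb R^q))$ be a random field, with jointly measurable values $\mathbf v(\mathbf x,\omega)$ and mean $\mathbb E[\mathbf v]=\mathbf 0$. Let $(\lambda_i,\phi_i)_{i\ge1}$ be the eigensystem defining its Karhunen-Loève expansion $\mathbf v=\sum_{i\ge1}\lambda_i^{1/2}\phi_iY_i$: $(\phi_i)$ is orthonormal in $L^2(U;\mathbb R^q)$, $\lambda_1\ge\lambda_2\ge\dots\ge0$, and the covariance operator $(\mathcal C_{\mathbf v}\mathbf u)(\mathbf x)=\int_U{\rm Cov}(\mathbf v(\mathbf x),\mathbf v(\mathbf y))\,\mathbf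 u(\mathbf y)\,d\mathbf y$ satisfies $\mathcal C_{\mathbf v}\phi_i=\lambda_i\phi_i$ and $\mathcal C_{\mathbf v}\mathbf u=\sum_i\lambda_i(\mathbf u,\phi_i)\phi_i$ for all $\mathbf u\in L^2(U;\mathbb R^q)$. Fix an integer $M\ge0$. Multilevel basis. Let $\boldsymbol\chi^j_\tau=c^j_\tau 1_\tau e_j$ ($\tau\in\mathcal S$, $1\le j\le q$), where $e_j$ is the $j$-th standard unit vector of $\mathbb R^q$ and the constants $c^j_\tau$ are such that these functions are orthonormal in $L^2(U;\mathbb R^q)$. Let a finite binary tree of cells be built by recursively bisecting the set of barycenters of the simplices in $\mathcal S$: the root contains all barycenters, a cell with fewer than $n_0$ barycenters is a leaf, and every other cell is split in two by some rule on the barycenters (for instance the median rule in the coordinate direction of maximal variance, which gives a kd-tree). From the leaves to the root, each cell receives a finite list $\mathcal E=(e_1,\dots,e_s)$ of functions: for a leaf, all $\boldsymbol\chi^j_\tau$ with $\tau$ in the cell; for any other cell, the functions $\boldsymbol\phi_j$ (see below) of its two children, in any order. Let $\mathbf M=((\phi_i,e_j))_{1\le i\le M,\,1\le j\le s}$ have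 rank $a$ and singular value decomposition $\mathbf M=\mathbf U\mathbf D\mathbf V^{\rm T}$ (non-increasing singular values, $\mathbf U,\mathbf V$ orthogonal), and put $\boldsymbol\phi_j=\sum_i\mathbf V_{ij}e_i$ for $j\le a$ and $\boldsymbol\psi_j=\sum_i\mathbf V_{ij}e_i$ for $a<j\le s$. Write $\boldsymbol\psi^{l,k'}_p$, $a<p\le s$, for the functions $\boldsymbol\psi_p$ obtained in the $k'$-th cell at level $l$. Lemma. The series $\sum_{i\ge M+1}\lambda_i$ converges, and for every $l\ge0$, every cell at level $l$ and every function $\boldsymbol\psi^{l,k'}_p$ of that cell, the projection coefficient $$d^{l,k'}_p(\omega)=\int_U\mathbf v(\mathbf x,\omega)^{\rm T}\boldsymbol\psi^{l,k'}_p(\mathbf x)\,d\mathbf x$$ is square integrable on $\Omega$ and satisfies $$\mathbb E\big[d^{l,k'}_p\big]=0\qquad\text{and}\qquad\mathbb E\big[(d^{l,k'}_p)^2\big]\le\sum_{i\ge M+1}\lambda_i .$$ -/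

import Mathlib

open MeasureTheory ProbabilityTheory
open scoped ENNReal

noncomputable section

namespace MultilevelKL

/-! ### Domains made of simplices -/

/-- The union of the (closed) simplices with vertex sets in `𝒮`. -/
def domain {d : ℕ} (𝒮 : Finset (Finset (EuclideanSpace ℝ (Fin d)))) :
    Set (EuclideanSpace ℝ (Fin d)) :=
  ⋃ τ ∈ 𝒮, convexHull ℝ (τ : Set (EuclideanSpace ℝ (Fin d)))

/-- The `k`-dimensional volume on the domain, i.e. the measure `dx` on `U`. The Euclidean Hausdorff
measure `μHE[k]` is normalised to be Lebesgue measure when `k = d`. -/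
def domainMeasure {d : ℕ} (k : ℕ) (𝒮 : Finset (Finset (EuclideanSpace ℝ (Fin d)))) :
    Measure (EuclideanSpace ℝ (Fin d)) :=
  (Measure.euclideanHausdorffMeasure k).restrict (domain 𝒮)

/-- `L²(μ; ℝ^q)`; its inner product is `(u, w) = ∫ uᵀ w dμ`. -/
abbrev L2 {d : ℕ} (μ : Measure (EuclideanSpace ℝ (Fin d))) (q : ℕ) : Type :=
  Lp (EuclideanSpace ℝ (Fin q)) 2 μ

/-! ### Random fields, covariance operator, Karhunen-Loève eigensystem -/

section KL

variable {Ω : Type*} [MeasurableSpace Ω] {d q : ℕ}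

/-- `v ∈ L²_P(Ω; L²(μ; ℝ^q))`, and `f ω x = v(x, ω)` are (jointly measurable) pointwise values
of `v`. -/
structure IsRandomField (P : Measure Ω) (μ : Measure (EuclideanSpace ℝ (Fin d)))
    (v : Ω → L2 μ q) (f : Ω → EuclideanSpace ℝ (Fin d) → EuclideanSpace ℝ (Fin q)) : Prop where
  memLp : MemLp v 2 P
  measurable : AEStronglyMeasurable (Function.uncurry f) (P.prod μ)
  values : ∀ᵐ ω ∂P, v ω =ᵐ[μ] f ω

/-- The mean `E[v](x) = (E[v_1(x, ·)], …, E[v_q(x, ·)])`. -/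
def mean (P : Measure Ω) (f : Ω → EuclideanSpace ℝ (Fin d) → EuclideanSpace ℝ (Fin q))
    (x : EuclideanSpace ℝ (Fin d)) : EuclideanSpace ℝ (Fin q) :=
  WithLp.toLp 2 fun i => ∫ ω, f ω x i ∂P

/-- The matrix-valued covariance function `Cov(v(x), v(y))`. -/
def covFn (P : Measure Ω) (f : Ω → EuclideanSpace ℝ (Fin d) → EuclideanSpace ℝ (Fin q))
    (x y : EuclideanSpace ℝ (Fin d)) : Matrix (Fin q) (Fin q) ℝ :=
  Matrix.of fun i j => covariance (fun ω => f ω x i) (fun ω => f ω y j) P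

/-- The covariance operator `(C_v u)(x) = ∫_U Cov(v(x), v(y)) u(y) dy`. -/
def covOp (P : Measure Ω) (μ : Measure (EuclideanSpace ℝ (Fin d)))
    (f : Ω → EuclideanSpace ℝ (Fin d) → EuclideanSpace ℝ (Fin q)) (u : L2 μ q)
    (x : EuclideanSpace ℝ (Fin d)) : EuclideanSpace ℝ (Fin q) :=
  ∫ y, WithLp.toLp 2 ((covFn P f x y).mulVec (u y)) ∂μ

/-- `(lam k, φ k)` is the eigensystem of the covariance operator that defines the Karhunen-Loève
expansion of the random field; indices start at `0`. -/
structure IsKLEigensystem (P : Measure Ω) (μ : Measure (EuclideanSpace ℝ (Fin d)))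
    (f : Ω → EuclideanSpace ℝ (Fin d) → EuclideanSpace ℝ (Fin q))
    (lam : ℕ → ℝ) (φ : ℕ → L2 μ q) : Prop where
  orthonormal : Orthonormal ℝ φ
  antitone : Antitone lam
  nonneg : ∀ k, 0 ≤ lam k
  eigen : ∀ k, covOp P μ f (φ k) =ᵐ[μ] fun x => lam k • φ k x
  spectral : ∀ u : L2 μ q, ∃ w : L2 μ q, covOp P μ f u =ᵐ[μ] w ∧
    HasSum (fun k => (lam k * inner ℝ u (φ k)) • φ k) w

end KL

/-! ### The multilevel basis -/

/-- `A = U D Vᵀ` is a singular value decomposition: `U`, `V` orthogonal, `D` rectangular diagonal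
with non-negative, non-increasing diagonal. -/
structure IsSVD {m n : ℕ} (A : Matrix (Fin m) (Fin n) ℝ) (U : Matrix (Fin m) (Fin m) ℝ)
    (D : Matrix (Fin m) (Fin n) ℝ) (V : Matrix (Fin n) (Fin n) ℝ) : Prop where
  left_mem : U ∈ Matrix.orthogonalGroup (Fin m) ℝ
  right_mem : V ∈ Matrix.orthogonalGroup (Fin n) ℝ
  off_diag : ∀ (i : Fin m) (j : Fin n), (i : ℕ) ≠ (j : ℕ) → D i j = 0
  diag_nonneg : ∀ (i : Fin m) (j : Fin n), (i : ℕ) = (j : ℕ) → 0 ≤ D i j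
  diag_antitone : ∀ (i i' : Fin m) (j j' : Fin n), (i : ℕ) = (j : ℕ) → (i' : ℕ) = (j' : ℕ) →
    i ≤ i' → D i' j' ≤ D i j
  eq : A = U * D * V.transpose

/-- A cell of the tree: the simplices whose barycenters it contains, the list of functions entering
the orthogonalisation in this cell, and the two lists which the orthogonalisation returns. -/
structure Cell (S H : Type*) where
  simplices : Finset S
  input : List H
  scaling : List H
  wavelets : List H

/-- Finite binary trees of cells. -/
inductive CellTree (S H : Type*) where
  | leaf (B : Cell S H) : CellTree S H
  | node (B : Cell S H) (left right : CellTree S H) : CellTree S H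

namespace CellTree

variable {S H : Type*}

/-- The cell at the root. -/
def root : CellTree S H → Cell S H
  | leaf B => B
  | node B _ _ => B

/-- The cells at level `l`. -/
def cellsAt : CellTree S H → ℕ → Set (Cell S H)
  | leaf B, 0 => {B}
  | leaf _, _ + 1 => ∅
  | node B _ _, 0 => {B}
  | node _ L R, l + 1 => L.cellsAt l ∪ R.cellsAt l

end CellTree

section Basis

variable {H : Type*} [NormedAddCommGroup H] [InnerProductSpace ℝ H]

/-- The linear combinations `∑ i, V i j • e_i` of the entries `e_i` of the list `e`, one for every
column `j` of `V`. -/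
def combine (e : List H) (V : Matrix (Fin e.length) (Fin e.length) ℝ) : List H :=
  List.ofFn fun j => ∑ i, V i j • e.get i

/-- One orthogonalisation step: `V` comes from a singular value decomposition of the matrix
`((φ_i, e_j))_{i, j}` (`i < M`) of rank `a`; its first `a` columns give the functions in `scaling`
and the remaining ones the functions in `wavelets`. -/
def IsOrthogonalised {S : Type*} (M : ℕ) (φ : ℕ → H) (B : Cell S H) : Prop :=
  ∃ (A : Matrix (Fin M) (Fin B.input.length) ℝ) (U : Matrix (Fin M) (Fin M) ℝ)
    (D : Matrix (Fin M) (Fin B.input.length) ℝ)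
    (V : Matrix (Fin B.input.length) (Fin B.input.length) ℝ),
    (∀ i j, A i j = inner ℝ (φ i) (B.input.get j)) ∧ IsSVD A U D V ∧
    B.scaling = (combine B.input V).take A.rank ∧
    B.wavelets = (combine B.input V).drop A.rank

open Classical in
/-- The tree is built by recursive bisection of sets of barycenters, and its cells carry the
multilevel basis. A cell with fewer than `n₀` barycenters is a leaf, every other one is split
by some rule (for a kd-tree: `x ↦ x i ≤ median` in the direction `i` of maximal variance).
The input of a leaf consists of the functions `χ τ j` with `τ` in the cell; the input of any other
cell consists of the scaling functions of its two children. -/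
def IsMultilevelTree {d q : ℕ} (n₀ M : ℕ) (φ : ℕ → H)
    (χ : Finset (EuclideanSpace ℝ (Fin d)) → Fin q → H) :
    CellTree (Finset (EuclideanSpace ℝ (Fin d))) H → Prop
  | .leaf B =>
      B.simplices.card < n₀ ∧
      B.input.Perm ((B.simplices ×ˢ Finset.univ).toList.map fun p => χ p.1 p.2) ∧
      IsOrthogonalised M φ B
  | .node B L R =>
      n₀ ≤ B.simplices.card ∧
      (∃ rule : EuclideanSpace ℝ (Fin d) → Prop,
        L.root.simplices = B.simplices.filter (fun τ => rule (τ.centroid ℝ id)) ∧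
        R.root.simplices = B.simplices.filter (fun τ => ¬ rule (τ.centroid ℝ id))) ∧
      B.input.Perm (L.root.scaling ++ R.root.scaling) ∧
      IsOrthogonalised M φ B ∧
      IsMultilevelTree n₀ M φ χ L ∧ IsMultilevelTree n₀ M φ χ R

/-- The functions `χ τ j = c τ j • 1_τ • e_j`, `τ ∈ 𝒮`, `j < q`, form an orthonormal set. -/
structure IsIndicatorBasis {d q : ℕ} {μ : Measure (EuclideanSpace ℝ (Fin d))}
    (𝒮 : Finset (Finset (EuclideanSpace ℝ (Fin d))))
    (c : Finset (EuclideanSpace ℝ (Fin d)) → Fin q → ℝ)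
    (χ : Finset (EuclideanSpace ℝ (Fin d)) → Fin q → L2 μ q) : Prop where
  eq_indicator : ∀ τ ∈ 𝒮, ∀ j, χ τ j =ᵐ[μ]
    (convexHull ℝ (τ : Set (EuclideanSpace ℝ (Fin d)))).indicator
      fun _ => c τ j • EuclideanSpace.single j (1 : ℝ)
  orthonormal : Orthonormal ℝ fun p : 𝒮 × Fin q => χ p.1 p.2

end Basis

end MultilevelKL

end

/-! For a wavelet `ψ` the coefficient is `d = (v, ψ)`. Fubini gives `E[(v, u)(v, w)] = (C_v u, w)`
(`inner_covOp`), hence `E[d²] = (C_v ψ, ψ) = ∑ λ_i (φ_i, ψ)²`. Two properties of `ψ` bound this sum.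
It is orthogonal to the first `M` eigenfunctions, because the columns of `V` beyond the rank lie in
the kernel of the moment matrix (`diag_eq_zero`, `inner_wavelet`). It is a unit vector, because
orthogonal matrices preserve orthonormality and sibling cells share no simplex (`root_scaling`). So
the first `M` terms vanish, and each other term is at most `λ_i`.

The eigenvalues are summable since `λ_i = E[(v, φ_i)²]` and Bessel's inequality bounds the partial
sums by `E‖v‖²`. Fubini also needs control of the volume; its finiteness is read off from the
normalised indicator functions (`isFiniteMeasure`). -/

noncomputable section

namespace MultilevelKL

/-! ### Orthonormality and vanishing moments of the multilevel basis -/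

section OrthonormalLists

variable {H : Type*} [NormedAddCommGroup H] [InnerProductSpace ℝ H]

/-- The entries of a list are unit vectors and pairwise orthogonal. -/
def OrthonormalList (l : List H) : Prop :=
  l.Pairwise (fun x y => inner ℝ x y = 0) ∧ ∀ x ∈ l, ‖x‖ = 1

theorem OrthonormalList.perm {l l' : List H} (h : OrthonormalList l) (hp : l'.Perm l) :
    OrthonormalList l' :=
  ⟨hp.symm.pairwise h.1 (fun hxy => by rw [real_inner_comm]; exact hxy),
    fun x hx => h.2 x (hp.mem_iff.1 hx)⟩

theorem OrthonormalList.sublist {l l' : List H} (h : OrthonormalList l) (hs : l'.Sublist l) :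
    OrthonormalList l' :=
  ⟨h.1.sublist hs, fun x hx => h.2 x (hs.subset hx)⟩

theorem OrthonormalList.append {l l' : List H} (h : OrthonormalList l) (h' : OrthonormalList l')
    (hll' : ∀ x ∈ l, ∀ y ∈ l', inner ℝ x y = 0) : OrthonormalList (l ++ l') :=
  ⟨List.pairwise_append.2 ⟨h.1, h'.1, hll'⟩,
    fun x hx => (List.mem_append.1 hx).elim (h.2 x) (h'.2 x)⟩

theorem OrthonormalList.orthonormal {l : List H} (h : OrthonormalList l) :
    Orthonormal ℝ l.get := by
  refine ⟨fun i => h.2 _ (List.get_mem l i), fun i j hij => ?_⟩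
  rcases lt_or_gt_of_ne hij with hlt | hlt
  · exact List.pairwise_iff_get.1 h.1 i j hlt
  · rw [real_inner_comm]
    exact List.pairwise_iff_get.1 h.1 j i hlt

theorem orthonormalList_ofFn {n : ℕ} {g : Fin n → H} (h : Orthonormal ℝ g) :
    OrthonormalList (List.ofFn g) := by
  refine ⟨List.pairwise_ofFn.2 fun i j hij => h.2 hij.ne, fun x hx => ?_⟩
  obtain ⟨i, rfl⟩ := List.mem_ofFn.1 hx
  exact h.1 i

theorem OrthonormalList.combine {e : List H} (h : OrthonormalList e)
    {V : Matrix (Fin e.length) (Fin e.length) ℝ}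
    (hV : V ∈ Matrix.orthogonalGroup (Fin e.length) ℝ) : OrthonormalList (combine e V) := by
  refine orthonormalList_ofFn (orthonormal_iff_ite.2 fun j j' => ?_)
  have hVV := congrFun (congrFun ((Matrix.mem_orthogonalGroup_iff' _ _).1 hV) j) j'
  rw [h.orthonormal.inner_sum]
  simpa [Matrix.mul_apply, Matrix.one_apply] using hVV

theorem mem_of_mem_combine {e : List H} {V : Matrix (Fin e.length) (Fin e.length) ℝ}
    {K : Submodule ℝ H} (hK : ∀ x ∈ e, x ∈ K) {x : H} (hx : x ∈ combine e V) : x ∈ K := by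
  obtain ⟨j, rfl⟩ := List.mem_ofFn.1 hx
  exact K.sum_mem fun i _ => K.smul_mem _ (hK _ (List.get_mem e i))

end OrthonormalLists

/-- A positive diagonal entry at position `j` makes all earlier ones positive by monotonicity. The
leading block of size `j + 1` is then invertible, which forces `rank A = rank D ≥ j + 1`. -/
theorem IsSVD.diag_eq_zero {m n : ℕ} {A : Matrix (Fin m) (Fin n) ℝ}
    {U : Matrix (Fin m) (Fin m) ℝ} {D : Matrix (Fin m) (Fin n) ℝ} {V : Matrix (Fin n) (Fin n) ℝ}
    (h : IsSVD A U D V) {j : Fin n} (hj : A.rank ≤ j) (i : Fin m) : D i j = 0 := by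
  by_cases hij : (i : ℕ) = j
  swap
  · exact h.off_diag i j hij
  by_contra hne
  have hpos : 0 < D i j := lt_of_le_of_ne (h.diag_nonneg i j hij) (Ne.symm hne)
  have hU : IsUnit U.det := by
    rw [← Matrix.isUnit_iff_isUnit_det]
    exact IsUnit.of_mul_eq_one _ ((Matrix.mem_orthogonalGroup_iff _ _).1 h.left_mem)
  have hV : IsUnit V.transpose.det := by
    rw [Matrix.det_transpose, ← Matrix.isUnit_iff_isUnit_det]
    exact IsUnit.of_mul_eq_one _ ((Matrix.mem_orthogonalGroup_iff _ _).1 h.right_mem)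
  have hrank : A.rank = D.rank := by
    rw [h.eq, Matrix.rank_mul_eq_left_of_isUnit_det _ _ hV,
      Matrix.rank_mul_eq_right_of_isUnit_det _ _ hU]
  -- The block fits into the rows because `i` and `j` have the same value.
  let r : Fin (j + 1) → Fin m := fun t => ⟨t, by have := t.2; have := i.2; omega⟩
  let s : Fin (j + 1) → Fin n := fun t => ⟨t, by have := t.2; have := j.2; omega⟩
  have hsub : D.submatrix r s = Matrix.diagonal fun t => D (r t) (s t) := by
    ext t t'
    by_cases htt : t = t'
    · subst htt; simp
    · rw [Matrix.diagonal_apply_ne _ htt]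
      exact h.off_diag _ _ fun hc => htt (Fin.ext hc)
  have hunit : IsUnit (D.submatrix r s) := by
    rw [Matrix.isUnit_iff_isUnit_det, hsub, Matrix.det_diagonal, isUnit_iff_ne_zero]
    refine Finset.prod_ne_zero_iff.2 fun t _ => (lt_of_lt_of_le hpos ?_).ne'
    refine h.diag_antitone _ _ _ _ rfl hij (Fin.le_def.2 ?_)
    have := t.2
    change (t : ℕ) ≤ i
    omega
  have h1 : (D.submatrix r s).rank ≤ D.rank := Matrix.rank_submatrix_le D r s
  rw [Matrix.rank_of_isUnit _ hunit, Fintype.card_fin, ← hrank] at h1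
  omega

/-! ### Induction over the tree of cells. -/

section Tree

variable {H : Type*} [NormedAddCommGroup H] [InnerProductSpace ℝ H]

/-- The moments of the combined functions are the entries of `A V = U D`, whose columns from index
`rank A` on are zero. -/
theorem IsOrthogonalised.inner_wavelet {S : Type*} {M : ℕ} {φ : ℕ → H} {B : Cell S H}
    (h : IsOrthogonalised M φ B) {ψ : H} (hψ : ψ ∈ B.wavelets) {i : ℕ} (hi : i < M) :
    inner ℝ (φ i) ψ = 0 := by
  obtain ⟨A, U, D, V, hA, hsvd, -, hw⟩ := h
  rw [hw] at hψ
  obtain ⟨t, ht, rfl⟩ := List.mem_drop_iff_getElem.1 hψ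
  have hlen : A.rank + t < B.input.length := by
    simpa [combine, add_comm] using ht
  have hAV : A * V = U * D := by
    rw [hsvd.eq, Matrix.mul_assoc]
    have := (Matrix.mem_orthogonalGroup_iff' _ _).1 hsvd.right_mem
    rw [this, Matrix.mul_one]
  have hz := congrFun (congrFun hAV ⟨i, hi⟩) ⟨A.rank + t, hlen⟩
  have hD : (U * D) ⟨i, hi⟩ ⟨A.rank + t, hlen⟩ = 0 := by
    rw [Matrix.mul_apply]
    exact Finset.sum_eq_zero fun l _ => by
      rw [hsvd.diag_eq_zero (j := ⟨A.rank + t, hlen⟩) (Nat.le_add_right _ _) l, mul_zero]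
  rw [hD, Matrix.mul_apply] at hz
  simp only [combine, List.getElem_ofFn]
  rw [inner_sum, ← hz]
  refine Finset.sum_congr rfl fun l _ => ?_
  rw [inner_smul_right, hA, mul_comm]

theorem IsOrthogonalised.orthonormalList {S : Type*} {M : ℕ} {φ : ℕ → H} {B : Cell S H}
    (h : IsOrthogonalised M φ B) (hB : OrthonormalList B.input) :
    OrthonormalList B.scaling ∧ OrthonormalList B.wavelets := by
  obtain ⟨A, U, D, V, -, hsvd, hs, hw⟩ := h
  have hc := hB.combine hsvd.right_mem
  rw [hs, hw]
  exact ⟨hc.sublist (List.take_sublist _ _), hc.sublist (List.drop_sublist _ _)⟩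

theorem IsOrthogonalised.scaling_mem {S : Type*} {M : ℕ} {φ : ℕ → H} {B : Cell S H}
    (h : IsOrthogonalised M φ B) {K : Submodule ℝ H} (hK : ∀ x ∈ B.input, x ∈ K) :
    ∀ x ∈ B.scaling, x ∈ K := by
  obtain ⟨A, U, D, V, -, -, hs, -⟩ := h
  rw [hs]
  exact fun x hx => mem_of_mem_combine hK (List.mem_of_mem_take hx)

variable {d q : ℕ}

/-- The span of the functions `χ τ j` with `τ ∈ 𝒮`. -/
def cellSpan (χ : Finset (EuclideanSpace ℝ (Fin d)) → Fin q → H)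
    (𝒮 : Finset (Finset (EuclideanSpace ℝ (Fin d)))) : Submodule ℝ H :=
  Submodule.span ℝ {x | ∃ τ ∈ 𝒮, ∃ j, x = χ τ j}

theorem cellSpan_mono {χ : Finset (EuclideanSpace ℝ (Fin d)) → Fin q → H}
    {𝒮 𝒮' : Finset (Finset (EuclideanSpace ℝ (Fin d)))} (h : 𝒮 ⊆ 𝒮') :
    cellSpan χ 𝒮 ≤ cellSpan χ 𝒮' :=
  Submodule.span_mono fun _ ⟨τ, hτ, j, hx⟩ => ⟨τ, h hτ, j, hx⟩

theorem inner_eq_zero_of_mem_cellSpan {χ : Finset (EuclideanSpace ℝ (Fin d)) → Fin q → H}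
    {𝒮 𝒮₁ 𝒮₂ : Finset (Finset (EuclideanSpace ℝ (Fin d)))}
    (hχ : Orthonormal ℝ fun p : 𝒮 × Fin q => χ p.1 p.2) (h₁ : 𝒮₁ ⊆ 𝒮) (h₂ : 𝒮₂ ⊆ 𝒮)
    (hd : Disjoint 𝒮₁ 𝒮₂) {x y : H} (hx : x ∈ cellSpan χ 𝒮₁) (hy : y ∈ cellSpan χ 𝒮₂) :
    inner ℝ x y = 0 := by
  have hle : cellSpan χ 𝒮₁ ⟂ cellSpan χ 𝒮₂ := by
    refine Submodule.isOrtho_span.2 ?_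
    rintro _ ⟨τ, hτ, j, rfl⟩ _ ⟨τ', hτ', j', rfl⟩
    refine hχ.2 (i := (⟨τ, h₁ hτ⟩, j)) (j := (⟨τ', h₂ hτ'⟩, j')) fun hc => ?_
    simp only [Prod.mk.injEq, Subtype.mk.injEq] at hc
    exact Finset.disjoint_left.1 hd hτ (hc.1 ▸ hτ')
  exact hle.inner_eq hx hy

open Classical in
theorem orthonormalList_indicators {χ : Finset (EuclideanSpace ℝ (Fin d)) → Fin q → H}
    {𝒮 𝒮₁ : Finset (Finset (EuclideanSpace ℝ (Fin d)))}
    (hχ : Orthonormal ℝ fun p : 𝒮 × Fin q => χ p.1 p.2) (h₁ : 𝒮₁ ⊆ 𝒮) :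
    OrthonormalList
      ((𝒮₁ ×ˢ (Finset.univ : Finset (Fin q))).toList.map fun p => χ p.1 p.2) := by
  constructor
  · rw [List.pairwise_map]
    refine (Finset.nodup_toList (𝒮₁ ×ˢ (Finset.univ : Finset (Fin q)))).imp_of_mem ?_
    intro p p' hp hp' hne
    rw [Finset.mem_toList, Finset.mem_product] at hp hp'
    refine hχ.2 (i := (⟨p.1, h₁ hp.1⟩, p.2)) (j := (⟨p'.1, h₁ hp'.1⟩, p'.2)) fun hc => hne ?_
    simp only [Prod.mk.injEq, Subtype.mk.injEq] at hc
    exact Prod.ext hc.1 hc.2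
  · intro x hx
    obtain ⟨p, hp, rfl⟩ := List.mem_map.1 hx
    rw [Finset.mem_toList, Finset.mem_product] at hp
    exact hχ.1 (⟨p.1, h₁ hp.1⟩, p.2)

/-- The span condition on the scaling functions strengthens the induction: it makes the scaling
functions of two siblings mutually orthogonal, so that their concatenation is again an orthonormal
input. -/
theorem IsMultilevelTree.root_scaling {n₀ M : ℕ} {φ : ℕ → H}
    {χ : Finset (EuclideanSpace ℝ (Fin d)) → Fin q → H}
    {𝒮 : Finset (Finset (EuclideanSpace ℝ (Fin d)))}
    (hχ : Orthonormal ℝ fun p : 𝒮 × Fin q => χ p.1 p.2) :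
    ∀ {tree : CellTree (Finset (EuclideanSpace ℝ (Fin d))) H},
      IsMultilevelTree n₀ M φ χ tree → tree.root.simplices ⊆ 𝒮 →
      (OrthonormalList tree.root.scaling ∧
        ∀ x ∈ tree.root.scaling, x ∈ cellSpan χ tree.root.simplices) ∧
      ∀ l, ∀ B ∈ tree.cellsAt l, ∀ ψ ∈ B.wavelets,
        ‖ψ‖ = 1 ∧ ∀ i < M, inner ℝ (φ i) ψ = 0
  | .leaf B, h, hS => by
    obtain ⟨-, hp, ho⟩ := h
    have hon := ho.orthonormalList ((orthonormalList_indicators hχ hS).perm hp)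
    refine ⟨⟨hon.1, ho.scaling_mem fun x hx => ?_⟩, fun l C hC ψ hψ => ?_⟩
    · obtain ⟨p, hp', rfl⟩ := List.mem_map.1 (hp.mem_iff.1 hx)
      rw [Finset.mem_toList, Finset.mem_product] at hp'
      exact Submodule.subset_span ⟨p.1, hp'.1, p.2, rfl⟩
    · cases l with
      | zero =>
        obtain rfl : C = B := hC
        exact ⟨hon.2.2 ψ hψ, fun i hi => ho.inner_wavelet hψ hi⟩
      | succ l => exact absurd hC (Set.notMem_empty C)
  | .node B L R, h, hS => by
    classical
    obtain ⟨-, ⟨rule, hL, hR⟩, hp, ho, htL, htR⟩ := h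
    change B.simplices ⊆ 𝒮 at hS
    have hLB : L.root.simplices ⊆ B.simplices := by
      rw [hL]; exact Finset.filter_subset _ _
    have hRB : R.root.simplices ⊆ B.simplices := by
      rw [hR]; exact Finset.filter_subset _ _
    have hdisj : Disjoint L.root.simplices R.root.simplices := by
      rw [hL, hR]; exact Finset.disjoint_filter_filter_not _ _ _
    obtain ⟨⟨hLo, hLs⟩, hLw⟩ := IsMultilevelTree.root_scaling hχ htL (hLB.trans hS)
    obtain ⟨⟨hRo, hRs⟩, hRw⟩ := IsMultilevelTree.root_scaling hχ htR (hRB.trans hS)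
    have hon := ho.orthonormalList ((hLo.append hRo fun x hx y hy =>
      inner_eq_zero_of_mem_cellSpan hχ (hLB.trans hS) (hRB.trans hS) hdisj
        (hLs x hx) (hRs y hy)).perm hp)
    refine ⟨⟨hon.1, ho.scaling_mem fun x hx => ?_⟩, fun l C hC ψ hψ => ?_⟩
    · rcases List.mem_append.1 (hp.mem_iff.1 hx) with hx | hx
      · exact cellSpan_mono hLB (hLs x hx)
      · exact cellSpan_mono hRB (hRs x hx)
    · cases l with
      | zero =>
        obtain rfl : C = B := hC
        exact ⟨hon.2.2 ψ hψ, fun i hi => ho.inner_wavelet hψ hi⟩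
      | succ l =>
        rcases hC with hC | hC
        · exact hLw l C hC ψ hψ
        · exact hRw l C hC ψ hψ

end Tree

/-! ### The covariance operator -/

section Covariance

variable {Ω X E G : Type*} [MeasurableSpace Ω] [MeasurableSpace X]
  [NormedAddCommGroup E] [InnerProductSpace ℝ E] [NormedAddCommGroup G] [NormedSpace ℝ G]
  {P : Measure Ω} {μ : Measure X}

/-- Justifies every later exchange of integrals. The product `‖h‖ ‖u‖` is square integrable since
its square separates the variables; Hölder against `F` does the rest. -/
theorem integrable_inner_smul_prod [SFinite P] [SFinite μ] {F : Ω × X → E} {u : X → E} {h : Ω → G}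
    (hF : MemLp F 2 (P.prod μ)) (hu : MemLp u 2 μ) (hh : MemLp h 2 P) :
    Integrable (fun z : Ω × X => (inner ℝ (F z) (u z.2) : ℝ) • h z.1) (P.prod μ) := by
  have hu' : AEStronglyMeasurable (fun z : Ω × X => u z.2) (P.prod μ) := hu.1.comp_snd
  have hh' : AEStronglyMeasurable (fun z : Ω × X => h z.1) (P.prod μ) := hh.1.comp_fst
  have hprod : MemLp (fun z : Ω × X => ‖h z.1‖ * ‖u z.2‖) 2 (P.prod μ) := by
    refine (memLp_two_iff_integrable_sq (hh'.norm.mul hu'.norm)).2 ?_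
    refine Integrable.congr (f := fun z : Ω × X => ‖h z.1‖ ^ 2 * ‖u z.2‖ ^ 2) ?_
      (ae_of_all _ fun z => (mul_pow _ _ 2).symm)
    exact ((memLp_two_iff_integrable_sq_norm hh.1).1 hh).mul_prod
      ((memLp_two_iff_integrable_sq_norm hu.1).1 hu)
  refine (hF.norm.integrable_mul hprod).mono ((hF.1.inner hu').smul hh') (ae_of_all _ fun z => ?_)
  rw [norm_smul, Pi.mul_apply, norm_mul, norm_mul, norm_norm, norm_norm, norm_norm]
  calc _ ≤ ‖F z‖ * ‖u z.2‖ * ‖h z.1‖ := by gcongr; exact norm_inner_le_norm _ _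
    _ = _ := by ring

end Covariance

variable {Ω : Type*} [MeasurableSpace Ω] {d q : ℕ} {P : Measure Ω}
  {μ : Measure (EuclideanSpace ℝ (Fin d))} {v : Ω → L2 μ q}
  {f : Ω → EuclideanSpace ℝ (Fin d) → EuclideanSpace ℝ (Fin q)}

namespace IsRandomField

theorem inner_eq (hv : IsRandomField P μ v f) (u : L2 μ q) :
    ∀ᵐ ω ∂P, (inner ℝ (v ω) u : ℝ) = ∫ x, inner ℝ (f ω x) (u x) ∂μ := by
  filter_upwards [hv.values] with ω hω
  rw [L2.inner_def]
  refine integral_congr_ae ?_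
  filter_upwards [hω] with x hx
  rw [hx]

theorem memLp_inner (hv : IsRandomField P μ v f) (u : L2 μ q) :
    MemLp (fun ω => (inner ℝ (v ω) u : ℝ)) 2 P :=
  hv.memLp.inner_const u

/-- Covariances are second moments, because the mean vanishes. -/
theorem covFn_mulVec {x y : EuclideanSpace ℝ (Fin d)} (hx : MemLp (fun ω => f ω x) 2 P)
    (hy : MemLp (fun ω => f ω y) 2 P) (hmx : mean P f x = 0) (hmy : mean P f y = 0)
    (u : EuclideanSpace ℝ (Fin q)) :
    WithLp.toLp 2 ((covFn P f x y).mulVec u) = ∫ ω, (inner ℝ (f ω y) u : ℝ) • f ω x ∂P := by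
  have hcoord : ∀ {z : EuclideanSpace ℝ (Fin d)}, MemLp (fun ω => f ω z) 2 P →
      ∀ i, MemLp (fun ω => f ω z i) 2 P := fun hz i =>
    (EuclideanSpace.proj (𝕜 := ℝ) i).comp_memLp' hz
  have hyu : MemLp (fun ω => (inner ℝ (f ω y) u : ℝ)) 2 P := hy.inner_const u
  have hint : Integrable (fun ω => (inner ℝ (f ω y) u : ℝ) • f ω x) P :=
    memLp_one_iff_integrable.1 (hx.smul hyu)
  have hm : ∀ {z : EuclideanSpace ℝ (Fin d)}, mean P f z = 0 → ∀ i, ∫ ω, f ω z i ∂P = 0 :=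
    fun hz i => congrArg (fun w : EuclideanSpace ℝ (Fin q) => w i) hz
  ext i
  have h1 := (EuclideanSpace.proj (𝕜 := ℝ) i).integral_comp_comm hint
  simp only [PiLp.proj_apply] at h1
  rw [← h1]
  simp only [Matrix.mulVec, dotProduct, covFn, Matrix.of_apply, covariance, hm hmx, hm hmy,
    sub_zero, PiLp.smul_apply, smul_eq_mul, PiLp.inner_apply, RCLike.inner_apply, conj_trivial,
    Finset.sum_mul]
  rw [integral_finsetSum]
  · refine Finset.sum_congr rfl fun j _ => ?_
    rw [← integral_mul_const]
    congr 1 with ω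
    ring
  · intro j _
    refine (((hcoord hx i).integrable_mul (hcoord hy j)).mul_const (u j)).congr (ae_of_all _ ?_)
    intro ω
    simp only [Pi.mul_apply]
    ring

variable [SFinite μ]

/-- Tonelli: integrating `‖f ω x‖²` over `x` gives `‖v ω‖²`, which is integrable in `ω`. -/
theorem memLp_uncurry (hv : IsRandomField P μ v f) :
    MemLp (Function.uncurry f) 2 (P.prod μ) := by
  refine (memLp_two_iff_integrable_sq_norm hv.measurable).2 ?_
  refine (integrable_prod_iff (hv.measurable.norm.pow 2)).2 ⟨?_, ?_⟩
  · filter_upwards [hv.values] with ω hω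
    have := (Lp.memLp (v ω)).ae_eq hω
    exact (memLp_two_iff_integrable_sq_norm this.1).1 this
  · refine ((memLp_two_iff_integrable_sq_norm hv.memLp.1).1 hv.memLp).congr ?_
    filter_upwards [hv.values] with ω hω
    rw [← real_inner_self_eq_norm_sq, L2.inner_def]
    refine integral_congr_ae ?_
    filter_upwards [hω] with x hx
    simp [hx, Function.uncurry]

variable [IsProbabilityMeasure P]

/-- Ensures that, for almost all points, the covariances are true second moments and not default
values of divergent integrals. -/
theorem memLp_slice (hv : IsRandomField P μ v f) :
    ∀ᵐ x ∂μ, MemLp (fun ω => f ω x) 2 P := by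
  have h1 := ((memLp_two_iff_integrable_sq_norm hv.measurable).1 hv.memLp_uncurry).prod_left_ae
  have h2 := hv.measurable.prod_swap.prodMk_left
  filter_upwards [h1, h2] with x hx1 hx2
  exact (memLp_two_iff_integrable_sq_norm hx2).2 hx1

theorem covOp_eq (hv : IsRandomField P μ v f) (hmean : ∀ᵐ x ∂μ, mean P f x = 0) (u : L2 μ q) :
    ∀ᵐ x ∂μ, covOp P μ f u x = ∫ ω, (inner ℝ (v ω) u : ℝ) • f ω x ∂P := by
  filter_upwards [hv.memLp_slice, hmean] with x hx hmx
  have h1 : covOp P μ f u x = ∫ y, ∫ ω, (inner ℝ (f ω y) (u y) : ℝ) • f ω x ∂P ∂μ := by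
    refine integral_congr_ae ?_
    filter_upwards [hv.memLp_slice, hmean] with y hy hmy
    exact covFn_mulVec hx hy hmx hmy (u y)
  have h2 := integrable_inner_smul_prod hv.memLp_uncurry (Lp.memLp u) hx
  rw [h1, ← integral_integral_swap (f := fun ω y => (inner ℝ (f ω y) (u y) : ℝ) • f ω x) h2]
  refine integral_congr_ae ?_
  filter_upwards [hv.inner_eq u] with ω hω
  rw [hω, integral_smul_const]

/-- Pair `C_v u = E[(v, u) v]` from `covOp_eq` with `w` and exchange the integrals a second time. -/
theorem inner_covOp (hv : IsRandomField P μ v f) (hmean : ∀ᵐ x ∂μ, mean P f x = 0)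
    {u g : L2 μ q} (hg : covOp P μ f u =ᵐ[μ] g) (w : L2 μ q) :
    (inner ℝ g w : ℝ) = ∫ ω, (inner ℝ (v ω) u : ℝ) * inner ℝ (v ω) w ∂P := by
  have h1 : (inner ℝ g w : ℝ) = ∫ x, ∫ ω, (inner ℝ (f ω x) (w x) : ℝ) • inner ℝ (v ω) u ∂P ∂μ := by
    rw [L2.inner_def]
    refine integral_congr_ae ?_
    filter_upwards [hg, hv.covOp_eq hmean u, hv.memLp_slice] with x hx1 hx2 hx3
    have hint : Integrable (fun ω => (inner ℝ (v ω) u : ℝ) • f ω x) P :=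
      memLp_one_iff_integrable.1 (hx3.smul (hv.memLp_inner u))
    rw [← hx1, hx2, real_inner_comm, ← integral_inner hint]
    refine integral_congr_ae (ae_of_all _ fun ω => ?_)
    simp only [inner_smul_right, smul_eq_mul]
    rw [real_inner_comm (f ω x), mul_comm]
  have h2 := integrable_inner_smul_prod hv.memLp_uncurry (Lp.memLp w) (hv.memLp_inner u)
  rw [h1, ← integral_integral_swap
    (f := fun ω x => (inner ℝ (f ω x) (w x) : ℝ) • (inner ℝ (v ω) u : ℝ)) h2]
  refine integral_congr_ae ?_
  filter_upwards [hv.inner_eq w] with ω hω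
  rw [integral_smul_const, hω, smul_eq_mul, mul_comm]

theorem integral_inner_eq_zero (hv : IsRandomField P μ v f) (hmean : ∀ᵐ x ∂μ, mean P f x = 0)
    (u : L2 μ q) : ∫ ω, (inner ℝ (v ω) u : ℝ) ∂P = 0 := by
  -- The weight `h = 1` gives plain Fubini; it is square integrable because `P` is finite.
  have h2 := integrable_inner_smul_prod hv.memLp_uncurry (Lp.memLp u)
    (memLp_const (μ := P) (p := 2) (1 : ℝ))
  simp only [smul_eq_mul, mul_one] at h2
  rw [integral_congr_ae (hv.inner_eq u),
    integral_integral_swap (f := fun ω x => (inner ℝ (f ω x) (u x) : ℝ)) h2]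
  refine integral_eq_zero_of_ae ?_
  filter_upwards [hmean, hv.memLp_slice] with x hx hx2
  have hint := hx2.integrable (by norm_num)
  have h0 : ∫ ω, f ω x ∂P = 0 := by
    ext i
    have h1 := (EuclideanSpace.proj (𝕜 := ℝ) i).integral_comp_comm hint
    simp only [PiLp.proj_apply] at h1
    rw [← h1]
    exact congrArg (fun w : EuclideanSpace ℝ (Fin q) => w i) hx
  simp only [real_inner_comm (u x)]
  rw [integral_inner hint, h0, inner_zero_right, Pi.zero_apply]

end IsRandomField

/-! ### Eigenvalues and second moments of the coefficients. -/

namespace IsKLEigensystem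

variable [IsProbabilityMeasure P] [SFinite μ] {lam : ℕ → ℝ} {φ : ℕ → L2 μ q}

theorem eigenvalue_eq (hKL : IsKLEigensystem P μ f lam φ) (hv : IsRandomField P μ v f)
    (hmean : ∀ᵐ x ∂μ, mean P f x = 0) (i : ℕ) :
    lam i = ∫ ω, (inner ℝ (v ω) (φ i) : ℝ) ^ 2 ∂P := by
  have hg : covOp P μ f (φ i) =ᵐ[μ] (lam i • φ i : L2 μ q) :=
    (hKL.eigen i).trans (Lp.coeFn_smul (lam i) (φ i)).symm
  have h := hv.inner_covOp hmean hg (φ i)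
  rw [real_inner_smul_left, real_inner_self_eq_norm_sq, hKL.orthonormal.1 i, one_pow,
    mul_one] at h
  simpa only [sq] using h

theorem summable (hKL : IsKLEigensystem P μ f lam φ) (hv : IsRandomField P μ v f)
    (hmean : ∀ᵐ x ∂μ, mean P f x = 0) : Summable lam := by
  refine summable_of_sum_le (c := ∫ ω, ‖v ω‖ ^ 2 ∂P) hKL.nonneg fun s => ?_
  have hsq : ∀ i, Integrable (fun ω => (inner ℝ (v ω) (φ i) : ℝ) ^ 2) P := fun i =>
    (hv.memLp_inner (φ i)).integrable_sq
  simp only [hKL.eigenvalue_eq hv hmean]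
  rw [← integral_finsetSum _ fun i _ => hsq i]
  refine integral_mono (integrable_finsetSum _ fun i _ => hsq i)
    ((memLp_two_iff_integrable_sq_norm hv.memLp.1).1 hv.memLp) fun ω => ?_
  have := hKL.orthonormal.sum_inner_products_le (v ω) (s := s)
  refine le_trans (le_of_eq (Finset.sum_congr rfl fun i _ => ?_)) this
  rw [real_inner_comm, Real.norm_eq_abs, sq_abs]

theorem integral_inner_sq_le (hKL : IsKLEigensystem P μ f lam φ) (hv : IsRandomField P μ v f)
    (hmean : ∀ᵐ x ∂μ, mean P f x = 0) {M : ℕ} {ψ : L2 μ q} (hψ : ‖ψ‖ = 1)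
    (hφψ : ∀ i < M, inner ℝ (φ i) ψ = 0) :
    ∫ ω, (inner ℝ (v ω) ψ : ℝ) ^ 2 ∂P ≤ ∑' i, lam (M + i) := by
  obtain ⟨w, hw, hsum⟩ := hKL.spectral ψ
  have h1 := hv.inner_covOp hmean hw ψ
  have h2 : HasSum (fun i => lam i * (inner ℝ (φ i) ψ : ℝ) ^ 2) (inner ℝ w ψ : ℝ) := by
    -- The spectral series converges in norm, so the pairing with `ψ` can be taken term by term.
    have h := hsum.mapL (innerSL ℝ ψ)
    simp only [innerSL_apply_apply] at h
    rw [real_inner_comm]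
    refine h.congr_fun ?_
    intro i
    rw [inner_smul_right, real_inner_comm ψ (φ i)]
    ring
  have h3 : HasSum (fun i => lam (i + M) * (inner ℝ (φ (i + M)) ψ : ℝ) ^ 2)
      (inner ℝ w ψ : ℝ) := by
    refine (hasSum_nat_add_iff (f := fun i => lam i * (inner ℝ (φ i) ψ : ℝ) ^ 2) M).2 ?_
    rwa [Finset.sum_eq_zero fun i hi => by
      rw [hφψ i (Finset.mem_range.1 hi)]; ring, add_zero]
  have hs : Summable fun i => lam (i + M) :=
    (summable_nat_add_iff M).2 (hKL.summable hv hmean)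
  simp only [sq, ← h1, add_comm M]
  refine hasSum_le (fun i => ?_) h3 hs.hasSum
  have hle : |(inner ℝ (φ (i + M)) ψ : ℝ)| ≤ 1 := by
    simpa [hKL.orthonormal.1, hψ] using abs_real_inner_le_norm (φ (i + M)) ψ
  exact mul_le_of_le_one_right (hKL.nonneg _) ((sq_le_one_iff_abs_le_one _).2 hle)

end IsKLEigensystem

/-! ### Finiteness of the volume -/

/-- A unit vector of the form `c 1_τ e_j` has `c ≠ 0`, and a nonzero constant on `τ` is square
integrable only if `τ` has finite measure. -/
theorem IsIndicatorBasis.measure_convexHull_lt_top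
    {𝒮 : Finset (Finset (EuclideanSpace ℝ (Fin d)))}
    {c : Finset (EuclideanSpace ℝ (Fin d)) → Fin q → ℝ}
    {χ : Finset (EuclideanSpace ℝ (Fin d)) → Fin q → L2 μ q} (hχ : IsIndicatorBasis 𝒮 c χ)
    {τ : Finset (EuclideanSpace ℝ (Fin d))} (hτ : τ ∈ 𝒮) (j : Fin q) :
    μ (convexHull ℝ (τ : Set (EuclideanSpace ℝ (Fin d)))) < ∞ := by
  have hmeas : MeasurableSet (convexHull ℝ (τ : Set (EuclideanSpace ℝ (Fin d)))) :=
    (τ.finite_toSet.isCompact_convexHull ℝ).measurableSet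
  have hmem := (Lp.memLp (χ τ j)).ae_eq (hχ.eq_indicator τ hτ j)
  by_cases h : c τ j • EuclideanSpace.single j (1 : ℝ) = 0
  · exfalso
    have h0 : χ τ j = 0 := by
      refine Lp.ext ((hχ.eq_indicator τ hτ j).trans ?_)
      rw [h]
      simp only [Set.indicator_zero]
      exact (Lp.coeFn_zero _ _ _).symm
    have h1 : ‖χ τ j‖ = 1 := hχ.orthonormal.1 (⟨τ, hτ⟩, j)
    rw [h0, norm_zero] at h1
    exact zero_ne_one h1
  · exact SimpleFunc.measure_lt_top_of_memLp_indicator two_ne_zero ENNReal.ofNat_ne_top h hmeas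
      hmem

theorem IsIndicatorBasis.isFiniteMeasure {k : ℕ}
    {𝒮 : Finset (Finset (EuclideanSpace ℝ (Fin d)))}
    {c : Finset (EuclideanSpace ℝ (Fin d)) → Fin q → ℝ}
    {χ : Finset (EuclideanSpace ℝ (Fin d)) → Fin q → L2 μ q} (hχ : IsIndicatorBasis 𝒮 c χ)
    (hμ : μ = domainMeasure k 𝒮) (j : Fin q) : IsFiniteMeasure μ := by
  have hcompl : μ (domain 𝒮)ᶜ = 0 := by
    have hmeas : MeasurableSet (domain 𝒮) :=
      𝒮.measurableSet_biUnion fun τ _ => (τ.finite_toSet.isCompact_convexHull ℝ).measurableSet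
    rw [hμ, domainMeasure, Measure.restrict_apply hmeas.compl, Set.compl_inter_self,
      measure_empty]
  refine ⟨?_⟩
  rw [← Set.union_compl_self (domain 𝒮)]
  refine (measure_union_le _ _).trans_lt ?_
  rw [hcompl, add_zero]
  exact measure_biUnion_lt_top 𝒮.finite_toSet fun τ hτ => hχ.measure_convexHull_lt_top hτ j

end MultilevelKL

end

/-! ### Assembly of the bound. -/

theorem mainTheorem6 {d q k : ℕ}
    (T : Geometry.SimplicialComplex ℝ (EuclideanSpace ℝ (Fin d)))
    (hT : ∀ τ ∈ T.faces, τ.card ≤ k + 1)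
    (S : Finset (Finset (EuclideanSpace ℝ (Fin d))))
    (hS : ∀ τ ∈ S, τ ∈ T.faces ∧ τ.card = k + 1)
    (μ : Measure (EuclideanSpace ℝ (Fin d))) (hμ : μ = MultilevelKL.domainMeasure k S)
    {Ω : Type*} [MeasurableSpace Ω] (P : Measure Ω) [IsProbabilityMeasure P]
    (v : Ω → MultilevelKL.L2 μ q)
    (f : Ω → EuclideanSpace ℝ (Fin d) → EuclideanSpace ℝ (Fin q))
    (hv : MultilevelKL.IsRandomField P μ v f)
    (hmean : ∀ᵐ x ∂μ, MultilevelKL.mean P f x = 0)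
    (lam : ℕ → ℝ) (φ : ℕ → MultilevelKL.L2 μ q)
    (hKL : MultilevelKL.IsKLEigensystem P μ f lam φ)
    (M : ℕ)
    (c : Finset (EuclideanSpace ℝ (Fin d)) → Fin q → ℝ)
    (χ : Finset (EuclideanSpace ℝ (Fin d)) → Fin q → MultilevelKL.L2 μ q)
    (hχ : MultilevelKL.IsIndicatorBasis S c χ)
    (n₀ : ℕ)
    (tree : MultilevelKL.CellTree (Finset (EuclideanSpace ℝ (Fin d))) (MultilevelKL.L2 μ q))
    (hroot : tree.root.simplices = S)
    (htree : MultilevelKL.IsMultilevelTree n₀ M φ χ tree) :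
    Summable (fun i => lam (M + i)) ∧
    ∀ (l : ℕ), ∀ B ∈ tree.cellsAt l, ∀ ψ ∈ B.wavelets, ∀ δ : Ω → ℝ,
      (∀ ω, δ ω = ∫ x, inner ℝ (v ω x) (ψ x) ∂μ) →
      MemLp δ 2 P ∧ ∫ ω, δ ω ∂P = 0 ∧ ∫ ω, δ ω ^ 2 ∂P ≤ ∑' i, lam (M + i) := by
  -- For `q = 0` the space `L²` is trivial and contains no unit vector `φ 0`. An index `j` is needed
  -- to obtain finiteness of `μ` from the indicator functions.
  have hq : ∃ _ : Fin q, True := by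
    by_contra hno
    have : IsEmpty (Fin q) := ⟨fun j => hno ⟨j, trivial⟩⟩
    exact hKL.orthonormal.ne_zero 0 (Lp.ext (ae_of_all _ fun x => Subsingleton.elim _ _))
  obtain ⟨j, -⟩ := hq
  have : IsFiniteMeasure μ := hχ.isFiniteMeasure hμ j
  have hsum := hKL.summable hv hmean
  refine ⟨by simpa only [add_comm M] using (summable_nat_add_iff M).2 hsum, ?_⟩
  intro l B hB ψ hψ δ hδ
  obtain ⟨hnorm, hφψ⟩ := (MultilevelKL.IsMultilevelTree.root_scaling hχ.orthonormal htree
    hroot.subset).2 l B hB ψ hψ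
  obtain rfl : δ = fun ω => (inner ℝ (v ω) ψ : ℝ) :=
    funext fun ω => (hδ ω).trans (L2.inner_def (𝕜 := ℝ) (v ω) ψ).symm
  exact ⟨hv.memLp_inner ψ, hv.integral_inner_eq_zero hmean ψ,
    hKL.integral_inner_sq_le hv hmean hnorm hφψ⟩
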